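/- Let $n\ge 1$ be an integer, $\mathbb K=\mathbb R$ or $\mathbb C$, $r>0$, and let $C=C([-r,0],\mathbb K^n)$ with the supremum norm. Let $L\colon C\to\mathbb K^n$ be a continuous linear map represented by $\eta\colon(-\infty,0]\to M_n(\mathbb K)$, that is: $\eta$ is of bounded variation on $[-r,0]$, $\eta$ is constant on $(-\infty,-r]$, and $L\psi=\int_{-r}^0 d\eta(\theta)\,\psi(\theta)$ (Riemann–Stieltjes integral) for all $\psi\in C$. Let $p\in[1,\infty]$ and let $\phi\in\mathcal M^p$, i.e. $\phi$ is an $\mathcal L^p$ function from $[-r,0]$ to $\mathbb K^n$, defined almost everywhere and at $0$. For an interval $J$, let $\mathcal L^p_{\mathrm{loc}}(J,\mathbb K^n)$ be the set of almost everywhere defined measurable functions on $J$ that are $p$-integrable (essentially bounded if $p=\infty$) on every closed and bounded interval contained in $J$. Let $x=x(\cdot\,;\phi)$ be the mild solution of $\dot x(t)=Lx_t$ under the initial condition $x_0=\phi$, i.e. $x\in\mathcal L^1_{\mathrm{loc}}([-r,\infty),\mathbb K^n)$ is defined on all of $[0,\infty)$, and $$x(t)=\phi(0)+L\int_0^t x_s\,ds\quad(t\ge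 0),\qquad x(t)=\phi(t)\quad(\text{a.e. } t\in[-r,0]),$$ where $\int_0^t x_s\,ds\in C$ is the function $\theta\mapsto\int_0^t x(s+\theta)\,ds$. Then $x$ is locally absolutely continuous on $[0,\infty)$ (absolutely continuous on every closed and bounded interval contained in $[0,\infty)$). Furthermore: 1. $x|_{[0,\infty)}$ is differentiable almost everywhere and its derivative belongs to $\mathcal L^p_{\mathrm{loc}}([0,\infty),\mathbb K^n)$. 2. There exists $f=f(\cdot\,;\phi)\in\mathcal L^p_{\mathrm{loc}}([0,\infty),\mathbb K^n)$ vanishing on $[r,\infty)$ such that, for almost every $t\ge 0$, the Riemann–Stieltjes integral below exists and $$\dot x(t)=\int_{-t}^0 d\eta(\theta)\,x(t+\theta)+f(t).$$ -/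

import Mathlib

open MeasureTheory Set

/-! `M_n(𝕜)` carries the operator norm induced by the norm of `Fin n → 𝕜`. -/
attribute [local instance] Matrix.linftyOpNormedAddCommGroup

namespace RFDE

variable {𝕜 : Type*} [RCLike 𝕜] {n : ℕ}

/-- `f ∈ 𝓛^p_loc(J, E)`: the function `f` is `p`-integrable (essentially bounded if `p = ∞`) on
every closed and bounded interval contained in `J`.  Functions that are only defined almost
everywhere on `J` are represented by arbitrary extensions to all of `ℝ`; the notion depends only
on the almost everywhere class of `f` on `J`. -/
def MemLpLoc {E : Type*} [NormedAddCommGroup E] (f : ℝ → E) (p : ENNReal) (J : Set ℝ) : Prop :=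
  ∀ a b : ℝ, Icc a b ⊆ J → MemLp f p (volume.restrict (Icc a b))

/-- `f` is locally absolutely continuous on the interval `J`: it is absolutely continuous on every
closed and bounded interval contained in `J`. -/
def LocallyAbsolutelyContinuousOn {E : Type*} [NormedAddCommGroup E]
    (f : ℝ → E) (J : Set ℝ) : Prop :=
  ∀ a b : ℝ, a ≤ b → Icc a b ⊆ J → AbsolutelyContinuousOnInterval f a b

/-- A tagged partition `a = t 0 ≤ t 1 ≤ ⋯ ≤ t m = b` of `[a, b]` with tags
`τ k ∈ [t k, t (k + 1)]` for `k < m`. -/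
structure TaggedPartition (a b : ℝ) where
  m : ℕ
  t : ℕ → ℝ
  τ : ℕ → ℝ
  t_zero : t 0 = a
  t_last : t m = b
  left_le_tag : ∀ k < m, t k ≤ τ k
  tag_le_right : ∀ k < m, τ k ≤ t (k + 1)

/-- The Riemann–Stieltjes sum `∑ₖ [α(tₖ₊₁) - α(tₖ)] f(τₖ)`. -/
def rsSum {a b : ℝ} (α : ℝ → Matrix (Fin n) (Fin n) 𝕜) (f : ℝ → Fin n → 𝕜)
    (P : TaggedPartition a b) : Fin n → 𝕜 :=
  ∑ k ∈ Finset.range P.m, Matrix.mulVec (α (P.t (k + 1)) - α (P.t k)) (f (P.τ k))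

/-- The Riemann–Stieltjes integral `∫_a^b dα(θ) f(θ)` of the vector-valued function `f` with respect
to the matrix-valued function `α` exists and equals `I`: the Riemann–Stieltjes sums converge to
`I` as the mesh of the tagged partition tends to `0`. -/
def HasRSIntegral (α : ℝ → Matrix (Fin n) (Fin n) 𝕜) (f : ℝ → Fin n → 𝕜) (a b : ℝ)
    (I : Fin n → 𝕜) : Prop :=
  ∀ ε > 0, ∃ δ > 0, ∀ P : TaggedPartition a b,
    (∀ k < P.m, P.t (k + 1) - P.t k < δ) → ‖rsSum α f P - I‖ < ε

/-- `η : (-∞, 0] → M_n(𝕜)` represents the continuous linear map `L : C([-r, 0], 𝕜ⁿ) → 𝕜ⁿ`: it is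
of bounded variation on `[-r, 0]`, constant on `(-∞, -r]`, and `L ψ = ∫_{-r}^0 dη(θ) ψ(θ)` for all
`ψ` as a Riemann–Stieltjes integral.  (Values of `η` on `(0, ∞)` play no role.) -/
structure Represents {r : ℝ} (hr : 0 < r) (η : ℝ → Matrix (Fin n) (Fin n) 𝕜)
    (L : C(Icc (-r) 0, Fin n → 𝕜) →L[𝕜] (Fin n → 𝕜)) : Prop where
  boundedVariationOn : BoundedVariationOn η (Icc (-r) 0)
  const : ∀ θ ≤ -r, η θ = η (-r)
  eq_integral : ∀ ψ : C(Icc (-r) 0, Fin n → 𝕜),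
    HasRSIntegral η (IccExtend (neg_nonpos.2 hr.le) ψ) (-r) 0 (L ψ)

theorem continuous_historyIntegral {r : ℝ} {x : ℝ → Fin n → 𝕜}
    (hx : MemLpLoc x 1 (Ici (-r))) {t : ℝ} (ht : 0 ≤ t) :
    Continuous fun θ : Icc (-r) 0 => ∫ s in (0 : ℝ)..t, x (s + θ) := by
  rcases isEmpty_or_nonempty (Icc (-r) 0) with h | ⟨⟨θ₀, hθ₀⟩⟩
  · exact continuous_of_const fun a => h.elim a
  have hr : -r ≤ 0 := hθ₀.1.trans hθ₀.2
  have hrt : -r ≤ t := hr.trans ht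
  have hI : IntegrableOn x (uIcc (-r) t) := by
    rw [uIcc_of_le hrt]
    exact memLp_one_iff_integrable.1 (hx (-r) t Icc_subset_Ici_self)
  have hII : ∀ u ∈ Icc (-r) t, ∀ v ∈ Icc (-r) t, IntervalIntegrable x volume u v := by
    intro u hu v hv
    refine (hI.mono_set ?_).intervalIntegrable
    rw [uIcc_of_le hrt]
    exact uIcc_subset_Icc hu hv
  have hc : ContinuousOn (fun u => ∫ s in (-r)..u, x s) (Icc (-r) t) := by
    have := intervalIntegral.continuousOn_primitive_interval hI
    rwa [uIcc_of_le hrt] at this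
  have h1 : ∀ θ : Icc (-r) 0, (θ : ℝ) ∈ Icc (-r) t := fun θ => ⟨θ.2.1, θ.2.2.trans ht⟩
  have h2 : ∀ θ : Icc (-r) 0, t + (θ : ℝ) ∈ Icc (-r) t := fun θ =>
    ⟨by linarith [θ.2.1], by linarith [θ.2.2]⟩
  have key : (fun θ : Icc (-r) 0 => ∫ s in (0 : ℝ)..t, x (s + θ)) =
      fun θ : Icc (-r) 0 => (∫ s in (-r)..(t + θ), x s) - ∫ s in (-r)..(θ : ℝ), x s := by
    funext θ
    rw [intervalIntegral.integral_comp_add_right, zero_add,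
      intervalIntegral.integral_interval_sub_left
        (hII _ ⟨le_rfl, hrt⟩ _ (h2 θ)) (hII _ ⟨le_rfl, hrt⟩ _ (h1 θ))]
  rw [key]
  exact (hc.comp_continuous (continuous_const.add continuous_subtype_val) h2).sub
    (hc.comp_continuous continuous_subtype_val h1)

/-- The element `∫_0^t x_s ds` of `C([-r, 0], 𝕜ⁿ)`, that is, `θ ↦ ∫_0^t x(s + θ) ds`, for
`x ∈ 𝓛^1_loc([-r, ∞), 𝕜ⁿ)` and `t ≥ 0`. -/
noncomputable def historyIntegral {r : ℝ} {x : ℝ → Fin n → 𝕜}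
    (hx : MemLpLoc x 1 (Ici (-r))) {t : ℝ} (ht : 0 ≤ t) : C(Icc (-r) 0, Fin n → 𝕜) where
  toFun θ := ∫ s in (0 : ℝ)..t, x (s + θ)
  continuous_toFun := continuous_historyIntegral hx ht

/-- `φ ∈ 𝓜^p([-r, 0], 𝕜ⁿ)`: an `𝓛^p` function on `[-r, 0]`, defined almost everywhere and at `0`
(it is represented by an extension to all of `ℝ`, of which only the almost everywhere class on
`[-r, 0]` and the value at `0` are used). -/
def MemM (φ : ℝ → Fin n → 𝕜) (p : ENNReal) (r : ℝ) : Prop :=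
  MemLp φ p (volume.restrict (Icc (-r) 0))

/-- `x` is a mild solution of `ẋ(t) = L x_t` (`t ≥ 0`) under the initial condition `x_0 = φ`. -/
structure IsMildSolution {r : ℝ} (L : C(Icc (-r) 0, Fin n → 𝕜) →L[𝕜] (Fin n → 𝕜))
    (φ x : ℝ → Fin n → 𝕜) : Prop where
  memLpLoc : MemLpLoc x 1 (Ici (-r))
  eq_of_nonneg : ∀ (t : ℝ) (ht : 0 ≤ t), x t = φ 0 + L (historyIntegral memLpLoc ht)
  ae_eq_history : ∀ᵐ t ∂volume.restrict (Icc (-r) 0), x t = φ t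

end RFDE

/-!
Write `L ψ = ∫ dη ψ`. The sums defining this integral are bounded by those of the variation function
of `η`, so `‖L ψ‖ ≤ ∫ ‖ψ θ‖ dμ(θ)` for a finite measure `μ` on `[-r, 0]`
(`Represents.exists_measure`). For a mild solution `x` and `0 ≤ a ≤ b`,
`x b - x a = L (θ ↦ ∫_a^b x(s + θ) ds)`, hence Tonelli's theorem gives `‖x b - x a‖ ≤ ∫_a^b g` with
`g s = ∫ ‖x (s + θ)‖ dμ(θ)`, and `g` is `L^p` as soon as `x` is, by Young's inequality
(`ae_lt_top_and_memLp_lintegral_translate`, `IsMildSolution.exists_memLp_norm_sub_le`). The case of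
exponent `1` makes `x` locally absolutely continuous on `[0, ∞)`; in particular `x` is continuous
there and thus `L^p` on `[-r, T]`, and the case of exponent `p` together with `‖x'‖ ≤ g` almost
everywhere puts the derivative in `L^p`.

For the integral equation let `z` be the continuous function that agrees with `x` on `[0, ∞)` and is
constant on `(-∞, 0]`. Then `∫_{-t}^0 dη(θ) x(t + θ) = L z_t - (η(-t) - η(-r)) x(0)` for every `t ≥ 0`
(`Represents.hasRSIntegral_history`), since the integral is that over `[-r, 0]` minus the part where
`z (t + θ)` is constant, and `η` is constant on `(-∞, -r]`. The right side is measurable and locally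
bounded in `t`, so the difference `f` of the derivative and the integral is locally `L^p`. For
`t > r` no value of the initial function enters: there `x' = L x_t = L z_t` by the fundamental
theorem of calculus in `C([-r, 0], 𝕜ⁿ)` (`IsMildSolution.hasDerivAt`), and the correction term is
zero, so `f` vanishes.
-/

namespace RFDE
open Filter Topology
open scoped ENNReal

/-! ### Partitions and the variation function -/

section Measure
variable {𝕜 : Type*} [RCLike 𝕜] {n : ℕ}

lemma norm_sub_le_variationOnFromTo {E : Type*} [NormedAddCommGroup E] {η : ℝ → E} {s : Set ℝ}
    (hη : LocallyBoundedVariationOn η s) {c a b : ℝ} (hc : c ∈ s) (ha : a ∈ s) (hb : b ∈ s)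
    (hab : a ≤ b) :
    ‖η b - η a‖ ≤ variationOnFromTo η s c b - variationOnFromTo η s c a := by
  rw [variationOnFromTo.sub_right hη hc hb ha, variationOnFromTo.eq_of_le _ _ hab,
    ← ENNReal.ofReal_le_iff_le_toReal (hη a b ha hb), ← dist_eq_norm, ← edist_dist]
  exact eVariationOn.edist_le η ⟨hb, hab, le_rfl⟩ ⟨ha, le_rfl, hab⟩

/-- The partition of `[a, a + N * h]` into `N` intervals of length `h`, tagged at left ends. -/
def uniformPartition (a b h : ℝ) (N : ℕ) (hh : 0 ≤ h) (hb : a + N * h = b) :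
    TaggedPartition a b where
  m := N
  t k := a + k * h
  τ k := a + k * h
  t_zero := by simp
  t_last := hb
  left_le_tag _ _ := le_rfl
  tag_le_right k _ := by push_cast; linarith

lemma exists_uniform_mesh {l δ : ℝ} (hl : 0 ≤ l) (hδ : 0 < δ) :
    ∃ (N : ℕ) (h : ℝ), 0 ≤ h ∧ h < δ ∧ N * h = l := by
  obtain ⟨N, hN⟩ := exists_nat_gt (l / δ)
  have hN0 : (0 : ℝ) < N := (div_nonneg hl hδ.le).trans_lt hN
  refine ⟨N, l / N, by positivity, ?_, by field_simp⟩
  rw [div_lt_iff₀ hN0]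
  rwa [div_lt_iff₀ hδ, mul_comm] at hN

lemma norm_rsSum_le {a b : ℝ} (α : ℝ → Matrix (Fin n) (Fin n) 𝕜) (f : ℝ → Fin n → 𝕜)
    (P : TaggedPartition a b) :
    ‖rsSum α f P‖ ≤ ∑ k ∈ Finset.range P.m, ‖α (P.t (k + 1)) - α (P.t k)‖ * ‖f (P.τ k)‖ :=
  norm_sum_le_of_le _ fun _ _ => Matrix.linfty_opNorm_mulVec _ _

/-- A left-tagged Riemann–Stieltjes sum in which the `k`-th weight is the increment of `F` over the
doubled interval `[tₖ₋₁, tₖ₊₁]` is at most twice the Stieltjes integral of `u + ε`, where `ε` bounds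
the oscillation of `u` over one mesh. Doubling the intervals allows for the increments of a monotone
function that is not right-continuous; each point is then counted at most twice. -/
lemma sum_mul_le_two_mul_integral {F : StieltjesFunction ℝ} {u : ℝ → ℝ} (hu : Continuous u)
    (hu0 : ∀ θ, 0 ≤ u θ) {a h ε : ℝ} (hh : 0 ≤ h) (hh1 : h ≤ 1) (hε : 0 ≤ ε) (N : ℕ)
    (hosc : ∀ s t, |s - t| ≤ h → u s ≤ u t + ε) :
    ∑ k ∈ Finset.range N, (F (a + (k + 1) * h) - F (a + (k - 1) * h)) * u (a + k * h) ≤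
      2 * ∫ θ in Ioc (a - 1) (a + N * h), (u θ + ε) ∂F.measure := by
  set v : ℝ → ℝ := fun θ => u θ + ε
  have hv : Continuous v := hu.add continuous_const
  have hint : ∀ c d, IntervalIntegrable v F.measure c d := fun c d => hv.intervalIntegrable c d
  -- The nodes are shifted by one, so that `s 0` lies one step to the left of `a`.
  set s : ℕ → ℝ := fun k => a + (k - 1) * h with hs
  have hs_le : ∀ j k : ℕ, j ≤ k → s j ≤ s k := fun j k hjk => by
    have : (j : ℝ) ≤ k := by exact_mod_cast hjk
    simp only [hs]; gcongr
  have piece : ∀ c d w : ℝ, c ≤ d → (∀ θ ∈ Ioc c d, w ≤ v θ) →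
      (F d - F c) * w ≤ ∫ θ in c..d, v θ ∂F.measure := by
    intro c d w hcd hw
    have h1 : (F d - F c) * w = ∫ θ in c..d, w ∂F.measure := by
      rw [intervalIntegral.integral_of_le hcd, setIntegral_const, measureReal_def, F.measure_Ioc,
        ENNReal.toReal_ofReal (sub_nonneg.2 (F.mono hcd)), smul_eq_mul]
    rw [h1, intervalIntegral.integral_of_le hcd, intervalIntegral.integral_of_le hcd]
    exact setIntegral_mono_on (by simp) (hint c d).1 measurableSet_Ioc hw
  have hterm : ∀ k : ℕ, (F (a + (k + 1) * h) - F (a + (k - 1) * h)) * u (a + k * h) ≤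
      (∫ θ in s k..s (k + 1), v θ ∂F.measure) + ∫ θ in s (k + 1)..s (k + 2), v θ ∂F.measure := by
    intro k
    have e1 : s (k + 1) = a + k * h := by simp [hs]
    have e2 : s (k + 2) = a + (k + 1) * h := by simp only [hs]; push_cast; ring
    have e0 : s k = a + (k - 1) * h := rfl
    rw [← e1, ← e2, ← e0]
    calc (F (s (k + 2)) - F (s k)) * u (s (k + 1))
        = (F (s (k + 1)) - F (s k)) * u (s (k + 1)) +
          (F (s (k + 2)) - F (s (k + 1))) * u (s (k + 1)) := by ring
      _ ≤ _ := by
        refine add_le_add (piece _ _ _ (hs_le _ _ (by omega)) fun θ hθ => ?_)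
          (piece _ _ _ (hs_le _ _ (by omega)) fun θ hθ => ?_)
        · refine hosc _ _ ?_
          rw [e1, e0] at *
          rw [abs_le]; constructor <;> linarith [hθ.1, hθ.2]
        · refine hosc _ _ ?_
          rw [e1, e2] at *
          rw [abs_le]; constructor <;> linarith [hθ.1, hθ.2]
  have hmono : ∀ j k : ℕ, j ≤ k → k ≤ N + 1 → ∫ θ in s j..s k, v θ ∂F.measure ≤
      ∫ θ in Ioc (a - 1) (a + N * h), v θ ∂F.measure := by
    intro j k hjk hk
    rw [intervalIntegral.integral_of_le (hs_le j k hjk)]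
    refine setIntegral_mono_set (hint _ _).1
      (Eventually.of_forall fun θ => add_nonneg (hu0 θ) hε) (Ioc_subset_Ioc ?_ ?_).eventuallyLE
    · have := hs_le 0 j (Nat.zero_le _)
      simp only [hs, Nat.cast_zero, zero_sub] at this ⊢
      linarith
    · refine (hs_le k (N + 1) hk).trans (by simp [hs])
  calc _ ≤ ∑ k ∈ Finset.range N, ((∫ θ in s k..s (k + 1), v θ ∂F.measure) +
        ∫ θ in s (k + 1)..s (k + 2), v θ ∂F.measure) := Finset.sum_le_sum fun k _ => hterm k
    _ = (∫ θ in s 0..s N, v θ ∂F.measure) + ∫ θ in s 1..s (N + 1), v θ ∂F.measure := by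
        rw [Finset.sum_add_distrib,
          intervalIntegral.sum_integral_adjacent_intervals (fun k _ => hint _ _)]
        congr 1
        exact intervalIntegral.sum_integral_adjacent_intervals (a := fun k => s (k + 1))
          (fun k _ => hint _ _)
    _ ≤ _ := by
        rw [two_mul]
        exact add_le_add (hmono 0 N (by omega) (by omega)) (hmono 1 (N + 1) (by omega) le_rfl)

/-! ### Domination of the functional by a finite measure -/

/-- A functional represented by a function of bounded variation is dominated by a finite measure:
twice the Stieltjes measure of the variation function, pushed forward to `[-r, 0]`. The factor `2`
is not optimal, but makes it unnecessary to choose partitions avoiding the jumps of `η`. -/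
theorem Represents.exists_measure {r : ℝ} {hr : 0 < r} {η : ℝ → Matrix (Fin n) (Fin n) 𝕜}
    {L : C(Icc (-r) 0, Fin n → 𝕜) →L[𝕜] (Fin n → 𝕜)} (hη : Represents hr η L) :
    ∃ μ : Measure (Icc (-r) 0), IsFiniteMeasure μ ∧
      ∀ ψ : C(Icc (-r) 0, Fin n → 𝕜), ‖L ψ‖ₑ ≤ ∫⁻ θ, ‖ψ θ‖ₑ ∂μ := by
  have hr0 : -r ≤ 0 := neg_nonpos.2 hr.le
  have hloc := hη.boundedVariationOn.locallyBoundedVariationOn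
  have hleft : -r ∈ Icc (-r) 0 := left_mem_Icc.2 hr0
  set V : ℝ → ℝ := fun θ => variationOnFromTo η (Icc (-r) 0) (-r) (projIcc (-r) 0 hr0 θ) with hV
  have hVmono : Monotone V := fun a b hab =>
    variationOnFromTo.monotoneOn hloc hleft (projIcc (-r) 0 hr0 a).2 (projIcc (-r) 0 hr0 b).2
      (monotone_projIcc hr0 hab)
  set F := hVmono.stieltjesFunction
  -- The interval reaches to the left of `-r` so that a jump of `η` at `-r` is counted as well.
  set m : Measure ℝ := F.measure.restrict (Ioc (-r - 1) 0) with hm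
  have : IsFiniteMeasure m := ⟨by simp [hm, F.measure_Ioc]⟩
  refine ⟨(2 : ENNReal) • m.map (projIcc (-r) 0 hr0), ?_, fun ψ => ?_⟩
  · exact Measure.smul_finite _ (by simp)
  set u : ℝ → ℝ := fun θ => ‖IccExtend hr0 ψ θ‖ with hu
  have huc : Continuous u := ψ.continuous.Icc_extend'.norm
  have hui : Integrable u m := (huc.intervalIntegrable (-r - 1) 0).1
  suffices H : ‖L ψ‖ ≤ 2 * ∫ θ, u θ ∂m by
    rw [lintegral_smul_measure, lintegral_map (by fun_prop) continuous_projIcc.measurable,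
      ← ofReal_norm]
    refine (ENNReal.ofReal_le_ofReal H).trans_eq ?_
    rw [ENNReal.ofReal_mul (by norm_num), ofReal_integral_norm_eq_lintegral_enorm
      (f := IccExtend hr0 ψ) (hui.congr' (by
        exact ψ.continuous.Icc_extend'.aestronglyMeasurable) (by simp [hu]))]
    simp [IccExtend]
  have key : ∀ ε > 0, ‖L ψ‖ ≤ 2 * ∫ θ, (u θ + ε) ∂m + ε := by
    intro ε hε
    obtain ⟨δ₁, hδ₁, h₁⟩ := hη.eq_integral ψ ε hε
    have huu : UniformContinuous u :=
      uniformContinuous_norm.comp ((CompactSpace.uniformContinuous_of_continuous ψ.continuous).comp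
        (LipschitzWith.projIcc hr0).uniformContinuous)
    obtain ⟨δ₂, hδ₂, h₂⟩ := Metric.uniformContinuous_iff.1 huu ε hε
    obtain ⟨N, h, hh, hhδ, hN⟩ := exists_uniform_mesh hr.le
      (lt_min (lt_min hδ₁ hδ₂) one_pos)
    rcases hh.eq_or_lt with rfl | hhpos
    · simp at hN; linarith
    have hh1 := hhδ.trans_le (min_le_right _ _)
    have hhd1 := hhδ.trans_le ((min_le_left _ _).trans (min_le_left _ _))
    have hhd2 := hhδ.trans_le ((min_le_left _ _).trans (min_le_right _ _))
    let P := uniformPartition (-r) 0 h N hh (by linarith)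
    have hP : ‖rsSum η (IccExtend hr0 ψ) P‖ ≤ 2 * ∫ θ, (u θ + ε) ∂m := by
      have := sum_mul_le_two_mul_integral (F := F) huc (fun θ => norm_nonneg _) (a := -r) hh
        hh1.le hε.le N (fun s t hst => by
          have := h₂ (lt_of_le_of_lt (Real.dist_eq s t ▸ hst) hhd2)
          rw [Real.dist_eq] at this
          linarith [(abs_lt.1 this).2])
      rw [hN, neg_add_cancel] at this
      refine (norm_rsSum_le _ _ _).trans (le_trans (Finset.sum_le_sum fun k hk => ?_) this)
      have hk : k < N := Finset.mem_range.1 hk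
      have hk' : (k : ℝ) + 1 ≤ N := by exact_mod_cast hk
      refine mul_le_mul_of_nonneg_right ?_ (norm_nonneg _)
      have hk0 : (0 : ℝ) ≤ k := Nat.cast_nonneg k
      have m1 : -r + k * h ∈ Icc (-r) 0 := ⟨by nlinarith, by nlinarith⟩
      have m2 : -r + (k + 1) * h ∈ Icc (-r) 0 := ⟨by nlinarith, by nlinarith⟩
      have e : ∀ θ ∈ Icc (-r) 0, variationOnFromTo η (Icc (-r) 0) (-r) θ = V θ := fun θ hθ => by
        simp only [hV]; rw [projIcc_of_mem hr0 hθ]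
      have hle := norm_sub_le_variationOnFromTo hloc hleft m1 m2 (by nlinarith)
      rw [e _ m1, e _ m2] at hle
      -- `F` is the right limit of `V`, hence the lower bound has to be taken one node earlier.
      have i1 : V (-r + (k + 1) * h) ≤ F (-r + (k + 1) * h) := hVmono.le_rightLim le_rfl
      have i2 : F (-r + (k - 1) * h) ≤ V (-r + k * h) := hVmono.rightLim_le (by nlinarith)
      simp only [P, uniformPartition, Nat.cast_add, Nat.cast_one]
      linarith
    have hlim := h₁ P (fun k _ => by simp only [P, uniformPartition]; push_cast; linarith)
    have := norm_sub_norm_le (L ψ) (rsSum η (IccExtend hr0 ψ) P)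
    rw [norm_sub_rev] at this
    linarith
  have hlim : Tendsto (fun ε : ℝ => 2 * ∫ θ, (u θ + ε) ∂m + ε) (𝓝[>] 0)
      (𝓝 (2 * ∫ θ, u θ ∂m)) := by
    have : Continuous fun ε : ℝ => 2 * (∫ θ, u θ ∂m + m.real univ * ε) + ε := by fun_prop
    have h0 := (this.tendsto 0).mono_left (nhdsWithin_le_nhds (s := Ioi 0))
    simp only [mul_zero, add_zero] at h0
    refine h0.congr fun ε => ?_
    rw [integral_add hui (integrable_const _), integral_const, smul_eq_mul]
  exact ge_of_tendsto hlim (by filter_upwards [self_mem_nhdsWithin] with ε hε using key ε hε)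

end Measure

/-! ### Young's inequality for a finite measure -/

section Young
variable {E Ω : Type*} [NormedAddCommGroup E] [MeasurableSpace Ω] {μ : Measure Ω}
  [IsFiniteMeasure μ] {τ : Ω → ℝ} {y : ℝ → E} {p : ℝ≥0∞}

lemma measurable_lintegral_enorm_translate (hτ : Measurable τ) (hy : StronglyMeasurable y) :
    Measurable fun s => ∫⁻ θ, ‖y (s + τ θ)‖ₑ ∂μ :=
  Measurable.lintegral_prod_right'
    (f := fun q : ℝ × Ω => ‖y (q.1 + τ q.2)‖ₑ) (by
      have : Measurable fun q : ℝ × Ω => q.1 + τ q.2 := by fun_prop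
      exact hy.enorm.comp this)

/-- Young's inequality `L^p * M ⊆ L^p`: averaging the translates of an `L^p` function against a finite
measure gives an almost everywhere finite `L^p` function. -/
lemma ae_lt_top_and_memLp_lintegral_translate (hτ : Measurable τ) (hy : StronglyMeasurable y)
    (hp : 1 ≤ p) (hyp : MemLp y p volume) :
    (∀ᵐ s, ∫⁻ θ, ‖y (s + τ θ)‖ₑ ∂μ < ∞) ∧
      MemLp (fun s => (∫⁻ θ, ‖y (s + τ θ)‖ₑ ∂μ).toReal) p volume := by
  have hG := measurable_lintegral_enorm_translate (μ := μ) hτ hy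
  have hpair : Measurable fun q : ℝ × Ω => ‖y (q.1 + τ q.2)‖ₑ := by
    have : Measurable fun q : ℝ × Ω => q.1 + τ q.2 := by fun_prop
    exact hy.enorm.comp this
  have htr : ∀ θ, MeasurePreserving (fun s : ℝ => s + τ θ) volume volume :=
    fun θ => measurePreserving_add_right volume (τ θ)
  have hmeas : AEStronglyMeasurable (fun s => (∫⁻ θ, ‖y (s + τ θ)‖ₑ ∂μ).toReal) volume :=
    hG.ennreal_toReal.aestronglyMeasurable
  rcases eq_or_ne p ∞ with rfl | hpt
  · set M := eLpNorm y ∞ volume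
    have hM : M < ∞ := hyp.2
    have h1 : ∀ᵐ s, ∫⁻ θ, ‖y (s + τ θ)‖ₑ ∂μ ≤ M * μ univ := by
      have h2 : ∀ θ, ∀ᵐ s, ‖y (s + τ θ)‖ₑ ≤ M := fun θ => by
        have : ∀ᵐ s, ‖y s‖ₑ ≤ M := by
          simpa [M, eLpNorm_exponent_top] using enorm_ae_le_eLpNormEssSup y volume
        exact (htr θ).quasiMeasurePreserving.ae this
      -- For each `θ` the bound holds for almost every `s`; Fubini exchanges the quantifiers.
      have h3 : ∀ᵐ s, ∀ᵐ θ ∂μ, ‖y (s + τ θ)‖ₑ ≤ M := by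
        refine (Measure.ae_ae_comm (p := fun s θ => ‖y (s + τ θ)‖ₑ ≤ M) ?_).2 (ae_of_all _ h2)
        exact measurableSet_le hpair measurable_const
      filter_upwards [h3] with s hs
      exact (lintegral_mono_ae hs).trans_eq (by simp)
    have hlt : M * μ univ < ∞ := ENNReal.mul_lt_top hM (measure_lt_top _ _)
    refine ⟨h1.mono fun s hs => hs.trans_lt hlt, hmeas, ?_⟩
    rw [eLpNorm_exponent_top]
    refine (eLpNormEssSup_le_of_ae_enorm_bound (C := M * μ univ) ?_).trans_lt hlt
    filter_upwards [h1] with s hs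
    rw [Real.enorm_of_nonneg ENNReal.toReal_nonneg, ENNReal.ofReal_toReal (hs.trans_lt hlt).ne]
    exact hs
  · have hp0 : p ≠ 0 := (one_pos.trans_le hp).ne'
    have hpr : 0 < p.toReal := ENNReal.toReal_pos hp0 hpt
    set c : ℝ≥0∞ := μ univ ^ (1 / (1 : ℝ≥0∞).toReal - 1 / p.toReal) with hc
    have hct : c ≠ ∞ := by
      refine ENNReal.rpow_ne_top_of_nonneg ?_ (measure_ne_top _ _)
      have : 1 ≤ p.toReal := by
        simpa using (ENNReal.toReal_le_toReal (by simp) hpt).2 hp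
      have := (div_le_one hpr).2 this
      simpa using this
    -- Jensen's inequality for the finite measure `μ`.
    have hpow : ∀ s, (∫⁻ θ, ‖y (s + τ θ)‖ₑ ∂μ) ^ p.toReal ≤
        c ^ p.toReal * ∫⁻ θ, ‖y (s + τ θ)‖ₑ ^ p.toReal ∂μ := by
      intro s
      have hys : AEStronglyMeasurable (fun θ => y (s + τ θ)) μ :=
        (hy.comp_measurable (by fun_prop : Measurable fun θ => s + τ θ)).aestronglyMeasurable
      have := eLpNorm_le_eLpNorm_mul_rpow_measure_univ hp hys
      rw [eLpNorm_one_eq_lintegral_enorm, ← hc,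
        eLpNorm_eq_lintegral_rpow_enorm_toReal hp0 hpt] at this
      refine (ENNReal.rpow_le_rpow this hpr.le).trans_eq ?_
      rw [ENNReal.mul_rpow_of_nonneg _ _ hpr.le, ← ENNReal.rpow_mul, one_div,
        inv_mul_cancel₀ hpr.ne', ENNReal.rpow_one, mul_comm]
    have hfin : ∫⁻ s, (∫⁻ θ, ‖y (s + τ θ)‖ₑ ∂μ) ^ p.toReal < ∞ := by
      have hY : ∫⁻ s, ‖y s‖ₑ ^ p.toReal < ∞ :=
        lintegral_rpow_enorm_lt_top_of_eLpNorm_lt_top hp0 hpt hyp.2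
      calc _ ≤ ∫⁻ s, c ^ p.toReal * ∫⁻ θ, ‖y (s + τ θ)‖ₑ ^ p.toReal ∂μ := lintegral_mono hpow
        _ = c ^ p.toReal * ∫⁻ θ, ∫⁻ s, ‖y (s + τ θ)‖ₑ ^ p.toReal ∂volume ∂μ := by
          rw [lintegral_const_mul' _ _ (ENNReal.rpow_ne_top_of_nonneg hpr.le hct),
            lintegral_lintegral_swap]
          exact (hpair.pow_const _).aemeasurable
        _ = c ^ p.toReal * ((∫⁻ s, ‖y s‖ₑ ^ p.toReal) * μ univ) := by
          congr 1
          rw [← lintegral_const]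
          refine lintegral_congr fun θ => ?_
          exact lintegral_add_right_eq_self (fun s => ‖y s‖ₑ ^ p.toReal) (τ θ)
        _ < ∞ := ENNReal.mul_lt_top (ENNReal.rpow_lt_top_of_nonneg hpr.le hct)
            (ENNReal.mul_lt_top hY (measure_lt_top _ _))
    refine ⟨?_, hmeas, ?_⟩
    · filter_upwards [ae_lt_top (hG.pow_const _) hfin.ne] with s hs
      exact (ENNReal.rpow_lt_top_iff_of_pos hpr).1 hs
    · rw [eLpNorm_lt_top_iff_lintegral_rpow_enorm_lt_top hp0 hpt]
      refine (lintegral_mono fun s => ?_).trans_lt hfin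
      refine ENNReal.rpow_le_rpow ?_ hpr.le
      rw [Real.enorm_of_nonneg ENNReal.toReal_nonneg]
      exact ENNReal.ofReal_toReal_le

end Young

/-! ### Riemann–Stieltjes integrals over varying intervals -/

section RiemannStieltjes
variable {𝕜 : Type*} [RCLike 𝕜] {n : ℕ} {η : ℝ → Matrix (Fin n) (Fin n) 𝕜} {f : ℝ → Fin n → 𝕜}
  {a b c : ℝ} {I : Fin n → 𝕜}

lemma TaggedPartition.t_mono (P : TaggedPartition a b) :
    ∀ {j k : ℕ}, j ≤ k → k ≤ P.m → P.t j ≤ P.t k := by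
  intro j k hjk
  induction k, hjk using Nat.le_induction with
  | base => exact fun _ => le_rfl
  | succ k _ ih =>
    intro hk
    exact (ih (by omega)).trans
      ((P.left_le_tag k (by omega)).trans (P.tag_le_right k (by omega)))

lemma TaggedPartition.t_mem (P : TaggedPartition a b) {k : ℕ} (hk : k ≤ P.m) :
    P.t k ∈ Icc a b :=
  ⟨P.t_zero.symm.trans_le (P.t_mono (Nat.zero_le k) hk), (P.t_mono hk le_rfl).trans_eq P.t_last⟩

lemma TaggedPartition.tag_mem (P : TaggedPartition a b) {k : ℕ} (hk : k < P.m) :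
    P.τ k ∈ Icc a b :=
  ⟨(P.t_mem hk.le).1.trans (P.left_le_tag k hk), (P.tag_le_right k hk).trans (P.t_mem hk).2⟩

lemma HasRSIntegral.congr {g : ℝ → Fin n → 𝕜} (h : HasRSIntegral η f a b I)
    (hfg : EqOn f g (Icc a b)) : HasRSIntegral η g a b I := by
  intro ε hε
  obtain ⟨δ, hδ, H⟩ := h ε hε
  refine ⟨δ, hδ, fun P hP => ?_⟩
  have : rsSum η g P = rsSum η f P := Finset.sum_congr rfl fun k hk => by
    rw [hfg (P.tag_mem (Finset.mem_range.1 hk))]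
  rw [this]
  exact H P hP

/-- The concatenation of tagged partitions of `[a, c]` and `[c, b]`. -/
def TaggedPartition.append (Q : TaggedPartition a c) (P : TaggedPartition c b) :
    TaggedPartition a b where
  m := Q.m + P.m
  t k := if k < Q.m then Q.t k else P.t (k - Q.m)
  τ k := if k < Q.m then Q.τ k else P.τ (k - Q.m)
  t_zero := by
    split_ifs with h
    · exact Q.t_zero
    · have h0 : Q.m = 0 := by omega
      have h1 := Q.t_last
      rw [h0, Q.t_zero] at h1
      simp [P.t_zero, h1]
  t_last := by simp [P.t_last]
  left_le_tag k hk := by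
    split_ifs with h
    · exact Q.left_le_tag k h
    · exact P.left_le_tag _ (by omega)
  tag_le_right k hk := by
    rcases lt_trichotomy (k + 1) Q.m with h | h | h
    · rw [if_pos (by omega), if_pos h]
      exact Q.tag_le_right k (by omega)
    · rw [if_pos (by omega), if_neg (by omega), h, Nat.sub_self, P.t_zero]
      have := Q.tag_le_right k (by omega)
      rwa [h, Q.t_last] at this
    · rw [if_neg (by omega), if_neg (by omega), show k + 1 - Q.m = k - Q.m + 1 by omega]
      exact P.tag_le_right _ (by omega)

lemma TaggedPartition.append_left (Q : TaggedPartition a c) (P : TaggedPartition c b) {k : ℕ}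
    (hk : k ≤ Q.m) : (Q.append P).t k = Q.t k := by
  simp only [append]
  split_ifs with h
  · rfl
  · rw [show k = Q.m by omega, Nat.sub_self, P.t_zero, Q.t_last]

lemma TaggedPartition.append_right (Q : TaggedPartition a c) (P : TaggedPartition c b) (k : ℕ) :
    (Q.append P).t (Q.m + k) = P.t k := by
  simp [append]

lemma rsSum_append (Q : TaggedPartition a c) (P : TaggedPartition c b) :
    rsSum η f (Q.append P) = rsSum η f Q + rsSum η f P := by
  simp only [rsSum]
  rw [show (Q.append P).m = Q.m + P.m from rfl, Finset.sum_range_add]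
  congr 1
  · refine Finset.sum_congr rfl fun k hk => ?_
    have hk := Finset.mem_range.1 hk
    rw [Q.append_left P hk, Q.append_left P hk.le]
    simp [TaggedPartition.append, hk]
  · refine Finset.sum_congr rfl fun k _ => ?_
    rw [add_assoc, Q.append_right P, Q.append_right P]
    simp [TaggedPartition.append]

lemma rsSum_of_eqOn_const {v : Fin n → 𝕜} (hf : ∀ θ ∈ Icc a b, f θ = v)
    (P : TaggedPartition a b) : rsSum η f P = Matrix.mulVec (η b - η a) v := by
  have : rsSum η f P = ∑ k ∈ Finset.range P.m,
      (Matrix.mulVec (η (P.t (k + 1))) v - Matrix.mulVec (η (P.t k)) v) :=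
    Finset.sum_congr rfl fun k hk => by
      rw [hf _ (P.tag_mem (Finset.mem_range.1 hk)), Matrix.sub_mulVec]
  rw [this, Finset.sum_range_sub (fun k => Matrix.mulVec (η (P.t k)) v), P.t_last, P.t_zero,
    Matrix.sub_mulVec]

/-- If `f` is constant on `[a, c]`, the integral over `[c, b]` is obtained from the one over `[a, b]`:
a fine partition of `[c, b]` extends by a uniform one of `[a, c]`, whose sum telescopes. -/
theorem HasRSIntegral.restrict_of_eqOn_const {v : Fin n → 𝕜} (h : HasRSIntegral η f a b I)
    (hac : a ≤ c) (hf : ∀ θ ∈ Icc a c, f θ = v) :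
    HasRSIntegral η f c b (I - Matrix.mulVec (η c - η a) v) := by
  intro ε hε
  obtain ⟨δ, hδ, H⟩ := h ε hε
  refine ⟨δ, hδ, fun P hP => ?_⟩
  obtain ⟨N, l, hl, hlδ, hN⟩ := exists_uniform_mesh (sub_nonneg.2 hac) hδ
  let Q := uniformPartition a c l N hl (by linarith)
  have := H (Q.append P) fun k hk => by
    rcases lt_or_ge k Q.m with h | h
    · rw [Q.append_left P h, Q.append_left P h.le]
      simp only [Q, uniformPartition]
      push_cast
      linarith
    · obtain ⟨j, rfl⟩ := Nat.exists_eq_add_of_le h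
      rw [add_assoc, Q.append_right P, Q.append_right P]
      exact hP j (by simpa [TaggedPartition.append] using hk)
  rw [rsSum_append, rsSum_of_eqOn_const hf] at this
  rwa [sub_sub_eq_add_sub, add_comm (rsSum η f P)]

/-- The image of a tagged partition of `[c, b]` under `θ ↦ max a θ`. -/
def TaggedPartition.clampLeft (P : TaggedPartition c b) (hca : c ≤ a) (hab : a ≤ b) :
    TaggedPartition a b where
  m := P.m
  t k := max a (P.t k)
  τ k := max a (P.τ k)
  t_zero := by rw [P.t_zero, max_eq_left hca]
  t_last := by rw [P.t_last, max_eq_right hab]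
  left_le_tag k hk := max_le_max le_rfl (P.left_le_tag k hk)
  tag_le_right k hk := max_le_max le_rfl (P.tag_le_right k hk)

lemma TaggedPartition.sum_norm_sub_le (P : TaggedPartition a b)
    (hη : BoundedVariationOn η (Icc a b)) :
    ∑ k ∈ Finset.range P.m, ‖η (P.t (k + 1)) - η (P.t k)‖ ≤ (eVariationOn η (Icc a b)).toReal := by
  rw [← ENNReal.ofReal_le_iff_le_toReal hη, ENNReal.ofReal_sum_of_nonneg fun _ _ => norm_nonneg _]
  simp_rw [← dist_eq_norm, ← edist_dist]
  exact eVariationOn.sum_le_of_monotoneOn_Iic (u := P.t) (n := P.m)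
    (fun j _ k hk hjk => P.t_mono hjk hk) (fun k hk => P.t_mem hk)

/-- If `η` is constant on `(-∞, a]`, a Riemann–Stieltjes integral of a continuous function over
`[a, b]` is also its integral over `[c, b]` for `c ≤ a`. -/
theorem HasRSIntegral.extend_left (h : HasRSIntegral η f a b I) (hca : c ≤ a) (hab : a ≤ b)
    (hη : BoundedVariationOn η (Icc a b)) (hconst : ∀ θ ≤ a, η θ = η a)
    (hf : ContinuousOn f (Icc c b)) : HasRSIntegral η f c b I := by
  intro ε hε
  set K := (eVariationOn η (Icc a b)).toReal
  have hK : 0 ≤ K := ENNReal.toReal_nonneg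
  obtain ⟨δ₁, hδ₁, H⟩ := h (ε / 2) (half_pos hε)
  obtain ⟨δ₂, hδ₂, Hf⟩ := Metric.uniformContinuousOn_iff.1
    (isCompact_Icc.uniformContinuousOn_of_continuous hf) (ε / (2 * (K + 1))) (by positivity)
  refine ⟨min δ₁ δ₂, lt_min hδ₁ hδ₂, fun P hP => ?_⟩
  set Q := P.clampLeft hca hab
  have hmax : ∀ θ, η (max a θ) = η θ := fun θ => by
    rcases le_total a θ with h | h
    · rw [max_eq_right h]
    · rw [max_eq_left h, hconst θ h]
  have h1 : ‖rsSum η f Q - I‖ < ε / 2 := H Q fun k hk => by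
    have hPk := (hP k hk).trans_le (min_le_left _ _)
    have ht := P.t_mono (Nat.le_succ k) hk
    change max a (P.t (k + 1)) - max a (P.t k) < δ₁
    rcases le_total a (P.t k) with h | h
    · rw [max_eq_right h, max_eq_right (h.trans ht)]; exact hPk
    · rw [max_eq_left h, sub_lt_iff_lt_add]
      exact max_lt (by linarith) (by linarith)
  -- `P` and its clamped version carry the same weights; only the tags below `a` move, and such a tag
  -- moves by at most the mesh unless its weight is zero.
  have h2 : rsSum η f P - rsSum η f Q = ∑ k ∈ Finset.range P.m,
      Matrix.mulVec (η (Q.t (k + 1)) - η (Q.t k)) (f (P.τ k) - f (max a (P.τ k))) := by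
    simp only [rsSum]
    rw [show Q.m = P.m from rfl, ← Finset.sum_sub_distrib]
    refine Finset.sum_congr rfl fun k _ => ?_
    change _ - Matrix.mulVec (η (max a (P.t (k + 1))) - η (max a (P.t k))) (f (max a (P.τ k))) =
      Matrix.mulVec (η (max a (P.t (k + 1))) - η (max a (P.t k))) _
    rw [hmax, hmax, Matrix.mulVec_sub]
  have h3 : ‖rsSum η f P - rsSum η f Q‖ ≤ K * (ε / (2 * (K + 1))) := by
    rw [h2]
    refine le_trans (norm_sum_le_of_le (f := _)
      (n := fun k => ‖η (Q.t (k + 1)) - η (Q.t k)‖ * (ε / (2 * (K + 1)))) _ fun k hk => ?_) ?_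
    · have hk : k < P.m := Finset.mem_range.1 hk
      have hPk := (hP k hk).trans_le (min_le_right _ _)
      refine (Matrix.linfty_opNorm_mulVec _ _).trans ?_
      rcases le_total (P.t (k + 1)) a with h | h
      · have h' := (P.t_mono (Nat.le_succ k) hk).trans h
        have : Q.t (k + 1) = Q.t k := by
          change max a (P.t (k + 1)) = max a (P.t k)
          rw [max_eq_left h, max_eq_left h']
        simp [this]
      · refine mul_le_mul_of_nonneg_left ?_ (norm_nonneg _)
        rw [← dist_eq_norm]
        have hm := P.tag_mem hk
        refine (Hf _ hm _ ⟨hca.trans (le_max_left _ _), max_le hab hm.2⟩ ?_).le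
        rw [Real.dist_eq, abs_lt]
        have l1 := P.left_le_tag k hk
        have l2 := P.tag_le_right k hk
        constructor
        · have : max a (P.τ k) ≤ P.t (k + 1) := max_le h l2
          linarith
        · have := le_max_right a (P.τ k)
          linarith
    · rw [← Finset.sum_mul]
      exact mul_le_mul_of_nonneg_right (Q.sum_norm_sub_le hη) (by positivity)
  have h4 : K * (ε / (2 * (K + 1))) ≤ ε / 2 := by
    rw [mul_div_assoc', div_le_div_iff₀ (by positivity) two_pos]
    nlinarith
  calc ‖rsSum η f P - I‖ = ‖(rsSum η f P - rsSum η f Q) + (rsSum η f Q - I)‖ := by abel_nf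
    _ ≤ _ := norm_add_le _ _
    _ < ε := by linarith

end RiemannStieltjes

/-! ### Functions whose increments are dominated by an integral -/

section Dominated
variable {E : Type*} [NormedAddCommGroup E] {x : ℝ → E} {g : ℝ → ℝ} {a b : ℝ}

lemma absolutelyContinuousOnInterval_of_norm_sub_le (hg : IntervalIntegrable g volume a b)
    (hab : a ≤ b)
    (h : ∀ c d, a ≤ c → c ≤ d → d ≤ b → ‖x d - x c‖ ≤ ∫ s in c..d, g s) :
    AbsolutelyContinuousOnInterval x a b := by
  set F : ℝ → ℝ := fun t => ∫ s in a..t, g s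
  have hF : AbsolutelyContinuousOnInterval F a b :=
    hg.absolutelyContinuousOnInterval_intervalIntegral left_mem_uIcc
  have hsub : ∀ c ∈ Icc a b, ∀ d ∈ Icc a b, c ≤ d → dist (x c) (x d) ≤ dist (F c) (F d) := by
    intro c hc d hd hcd
    rw [dist_comm, dist_eq_norm, dist_comm, Real.dist_eq,
      intervalIntegral.integral_interval_sub_left]
    · exact (h c d hc.1 hcd hd.2).trans (le_abs_self _)
    all_goals
      refine hg.mono_set (uIcc_subset_uIcc left_mem_uIcc ?_)
      rw [uIcc_of_le hab]
      assumption
  have hdist : ∀ c ∈ Icc a b, ∀ d ∈ Icc a b, dist (x c) (x d) ≤ dist (F c) (F d) := by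
    intro c hc d hd
    rcases le_total c d with hcd | hcd
    · exact hsub c hc d hd hcd
    · rw [dist_comm (x c), dist_comm (F c)]
      exact hsub d hd c hc hcd
  rw [absolutelyContinuousOnInterval_iff] at hF ⊢
  intro ε hε
  obtain ⟨δ, hδ, H⟩ := hF ε hε
  refine ⟨δ, hδ, fun P hP hPδ => (Finset.sum_le_sum fun i hi => ?_).trans_lt (H P hP hPδ)⟩
  have := hP.1 i hi
  rw [uIcc_of_le hab] at this
  exact hdist _ this.1 _ this.2

lemma ae_norm_deriv_le_of_norm_sub_le [NormedSpace ℝ E] (hg : LocallyIntegrable g volume)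
    (h : ∀ c d, a ≤ c → c ≤ d → d ≤ b → ‖x d - x c‖ ≤ ∫ s in c..d, g s) :
    ∀ᵐ t, t ∈ Ico a b → DifferentiableAt ℝ x t → ‖deriv x t‖ ≤ g t := by
  filter_upwards [_root_.LocallyIntegrable.ae_hasDerivAt_integral hg] with t ht htab hx
  have h1 : Tendsto (fun s => ‖slope x t s‖) (𝓝[>] t) (𝓝 ‖deriv x t‖) :=
    ((hasDerivWithinAt_iff_tendsto_slope' self_notMem_Ioi).1
      hx.hasDerivAt.hasDerivWithinAt).norm
  have h2 := (hasDerivWithinAt_iff_tendsto_slope' self_notMem_Ioi).1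
    ((ht t).hasDerivWithinAt (s := Ioi t))
  refine le_of_tendsto_of_tendsto h1 h2 ?_
  filter_upwards [Ioo_mem_nhdsGT htab.2] with s hs
  have hts : 0 ≤ (s - t)⁻¹ := inv_nonneg.2 (sub_nonneg.2 hs.1.le)
  rw [slope_def_module, slope_def_module, norm_smul, intervalIntegral.integral_same, sub_zero,
    Real.norm_of_nonneg hts, smul_eq_mul]
  exact mul_le_mul_of_nonneg_left (h t s htab.1 hs.1.le hs.2.le) hts

lemma memLp_restrict_Icc_of_continuousOn {x : ℝ → E} {p : ℝ≥0∞} (hx : ContinuousOn x (Icc a b)) :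
    MemLp x p (volume.restrict (Icc a b)) := by
  obtain ⟨C, hC⟩ := isCompact_Icc.exists_bound_of_continuousOn hx
  exact MemLp.of_bound (hx.aestronglyMeasurable_of_isCompact isCompact_Icc measurableSet_Icc) C
    ((ae_restrict_iff' measurableSet_Icc).2 (ae_of_all _ hC))

end Dominated

/-! ### Regularity of mild solutions -/

variable {𝕜 : Type*} [RCLike 𝕜] {n : ℕ} {r : ℝ}
  {L : C(Icc (-r) 0, Fin n → 𝕜) →L[𝕜] (Fin n → 𝕜)} {η : ℝ → Matrix (Fin n) (Fin n) 𝕜}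
  {φ x : ℝ → Fin n → 𝕜} {p : ℝ≥0∞}

lemma MemLpLoc.intervalIntegrable_translate (hx : MemLpLoc x 1 (Ici (-r))) {a b : ℝ}
    (ha : 0 ≤ a) (hb : 0 ≤ b) (θ : Icc (-r) 0) :
    IntervalIntegrable (fun s => x (s + θ)) volume a b := by
  have h : IntervalIntegrable x volume (a + θ) (b + θ) := by
    have hI := memLp_one_iff_integrable.1 (hx (-r) (max a b + θ) Icc_subset_Ici_self)
    refine IntegrableOn.intervalIntegrable (IntegrableOn.mono_set hI ?_)
    have := θ.2.1
    refine uIcc_subset_Icc ⟨?_, ?_⟩ ⟨?_, ?_⟩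
    · linarith
    · linarith [le_max_left a b]
    · linarith
    · linarith [le_max_right a b]
  simpa using h.comp_add_right (θ : ℝ)

lemma historyIntegral_sub_apply (hx : MemLpLoc x 1 (Ici (-r))) {a b : ℝ}
    (ha : 0 ≤ a) (hb : 0 ≤ b) (θ : Icc (-r) 0) :
    (historyIntegral hx hb - historyIntegral hx ha) θ = ∫ s in a..b, x (s + θ) :=
  intervalIntegral.integral_interval_sub_left (hx.intervalIntegrable_translate le_rfl hb θ)
    (hx.intervalIntegrable_translate le_rfl ha θ)

lemma IsMildSolution.sub_eq (hx : IsMildSolution L φ x) {a b : ℝ} (ha : 0 ≤ a) (hb : 0 ≤ b) :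
    x b - x a = L (historyIntegral hx.memLpLoc hb - historyIntegral hx.memLpLoc ha) := by
  rw [hx.eq_of_nonneg b hb, hx.eq_of_nonneg a ha, map_sub, add_sub_add_left_eq_sub]

/-- The increments of a mild solution are dominated by the integral of `g s = ∫ ‖x (s + θ)‖ dμ(θ)`,
where `μ` is a measure dominating `L`. -/
theorem IsMildSolution.exists_memLp_norm_sub_le {hr : 0 < r} (hη : Represents hr η L)
    (hx : IsMildSolution L φ x) (hp : 1 ≤ p) {T : ℝ}
    (hxp : MemLp x p (volume.restrict (Icc (-r) T))) :
    ∃ g : ℝ → ℝ, MemLp g p volume ∧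
      ∀ a b, 0 ≤ a → a ≤ b → b ≤ T → ‖x b - x a‖ ≤ ∫ s in a..b, g s := by
  obtain ⟨μ, hμ, hL⟩ := hη.exists_measure
  -- A globally defined, strongly measurable `L^p` representative of `x` on `[-r, T]`.
  set y := (Icc (-r) T).indicator (hxp.1.mk x) with hy
  have hys : StronglyMeasurable y := hxp.1.stronglyMeasurable_mk.indicator measurableSet_Icc
  have hyp : MemLp y p volume :=
    (memLp_indicator_iff_restrict measurableSet_Icc).2 (hxp.ae_eq hxp.1.ae_eq_mk)
  have hxy : ∀ᵐ s, s ∈ Icc (-r) T → x s = y s := by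
    filter_upwards [(ae_restrict_iff' measurableSet_Icc).1 hxp.1.ae_eq_mk] with s hs hsT
    rw [hs hsT, hy, indicator_of_mem hsT]
  have hτ : Measurable ((↑) : Icc (-r) 0 → ℝ) := measurable_subtype_coe
  obtain ⟨hfin, hG⟩ := ae_lt_top_and_memLp_lintegral_translate (μ := μ) hτ hys hp hyp
  refine ⟨_, hG, fun a b ha hab hbT => ?_⟩
  have hb := ha.trans hab
  set G : ℝ → ℝ≥0∞ := fun s => ∫⁻ θ, ‖y (s + (θ : ℝ))‖ₑ ∂μ
  have hGint : IntegrableOn (fun s => (G s).toReal) (Ioc a b) :=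
    ((hG.locallyIntegrable hp).integrableOn_isCompact isCompact_Icc).mono_set Ioc_subset_Icc_self
  have key : ‖x b - x a‖ₑ ≤ ∫⁻ s in Ioc a b, G s := by
    rw [hx.sub_eq ha hb]
    refine (hL _).trans ?_
    have hθ : ∀ θ : Icc (-r) 0,
        ‖(historyIntegral hx.memLpLoc hb - historyIntegral hx.memLpLoc ha) θ‖ₑ ≤
          ∫⁻ s in Ioc a b, ‖y (s + θ)‖ₑ := by
      intro θ
      rw [historyIntegral_sub_apply, intervalIntegral.integral_of_le hab]
      refine (enorm_integral_le_lintegral_enorm _).trans_eq ?_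
      refine setLIntegral_congr_fun_ae measurableSet_Ioc ?_
      filter_upwards [(measurePreserving_add_right volume (θ : ℝ)).quasiMeasurePreserving.ae hxy]
        with s hs hsab
      rw [hs ⟨by linarith [θ.2.1, hsab.1], by linarith [θ.2.2, hsab.2]⟩]
    refine (lintegral_mono hθ).trans_eq (lintegral_lintegral_swap ?_)
    have : Measurable fun q : Icc (-r) 0 × ℝ => q.2 + (q.1 : ℝ) := by fun_prop
    exact (hys.enorm.comp this).aemeasurable
  have hGeq : ∫⁻ s in Ioc a b, G s = ENNReal.ofReal (∫ s in a..b, (G s).toReal) := by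
    rw [intervalIntegral.integral_of_le hab, ofReal_integral_eq_lintegral_ofReal hGint
      (ae_of_all _ fun s => ENNReal.toReal_nonneg)]
    refine lintegral_congr_ae (ae_restrict_of_ae ?_)
    filter_upwards [hfin] with s hs
    exact (ENNReal.ofReal_toReal hs.ne).symm
  rw [hGeq, ← ofReal_norm] at key
  exact (ENNReal.ofReal_le_ofReal_iff (intervalIntegral.integral_nonneg hab fun s _ =>
    ENNReal.toReal_nonneg)).1 key

theorem IsMildSolution.locallyAbsolutelyContinuousOn {hr : 0 < r} (hη : Represents hr η L)
    (hx : IsMildSolution L φ x) : LocallyAbsolutelyContinuousOn x (Ici 0) := by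
  intro a b hab hJ
  have ha : 0 ≤ a := hJ (left_mem_Icc.2 hab)
  -- Exponent `1` is all that is known before `x` is shown to be continuous on `[0, ∞)`.
  obtain ⟨g, hg, h⟩ := hx.exists_memLp_norm_sub_le hη le_rfl
    (hx.memLpLoc (-r) b Icc_subset_Ici_self)
  exact absolutelyContinuousOnInterval_of_norm_sub_le
    (memLp_one_iff_integrable.1 hg).intervalIntegrable hab
    fun c d hc hcd hd => h c d (ha.trans hc) hcd hd

lemma IsMildSolution.continuousOn {hr : 0 < r} (hη : Represents hr η L)
    (hx : IsMildSolution L φ x) : ContinuousOn x (Ici 0) := by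
  intro t ht
  have ht0 : (0 : ℝ) ≤ t + 1 := by linarith [mem_Ici.1 ht]
  have := (hx.locallyAbsolutelyContinuousOn hη 0 (t + 1) ht0 Icc_subset_Ici_self).continuousOn
  rw [uIcc_of_le ht0] at this
  refine (this t ⟨ht, by linarith⟩).mono_of_mem_nhdsWithin ?_
  rw [← Ici_inter_Iic]
  exact inter_mem self_mem_nhdsWithin (mem_nhdsWithin_of_mem_nhds (Iic_mem_nhds (by linarith)))

lemma IsMildSolution.ae_differentiableAt {hr : 0 < r} (hη : Represents hr η L)
    (hx : IsMildSolution L φ x) : ∀ᵐ t, 0 ≤ t → DifferentiableAt ℝ x t := by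
  have h : ∀ N : ℕ, ∀ᵐ t, t ∈ uIcc (0 : ℝ) N → DifferentiableAt ℝ x t := fun N =>
    (hx.locallyAbsolutelyContinuousOn hη 0 N N.cast_nonneg
      Icc_subset_Ici_self).boundedVariationOn.ae_differentiableAt_of_mem_uIcc
  filter_upwards [ae_all_iff.2 h] with t ht h0
  obtain ⟨N, hN⟩ := exists_nat_ge t
  exact ht N (by rw [uIcc_of_le N.cast_nonneg]; exact ⟨h0, hN⟩)

lemma IsMildSolution.memLp {hr : 0 < r} (hη : Represents hr η L) (hx : IsMildSolution L φ x)
    (hφ : MemM φ p r) {T : ℝ} (hT : 0 ≤ T) : MemLp x p (volume.restrict (Icc (-r) T)) := by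
  have h1 : MemLp x p (volume.restrict (Icc (-r) 0)) :=
    MemLp.ae_eq (hx.ae_eq_history.mono fun _ h => h.symm) hφ
  have h2 : MemLp x p (volume.restrict (Ioc 0 T)) :=
    (memLp_restrict_Icc_of_continuousOn ((hx.continuousOn hη).mono Icc_subset_Ici_self)).mono_measure
      (Measure.restrict_mono Ioc_subset_Icc_self le_rfl)
  rw [← memLp_indicator_iff_restrict measurableSet_Icc] at h1 ⊢
  rw [← memLp_indicator_iff_restrict measurableSet_Ioc] at h2
  rw [← Icc_union_Ioc_eq_Icc (neg_nonpos.2 hr.le) hT, indicator_union_of_disjoint]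
  · exact h1.add h2
  · exact disjoint_left.2 fun s hs hs' => hs'.1.not_ge hs.2

lemma derivWithin_Ici_eq_deriv {E : Type*} [NormedAddCommGroup E] [NormedSpace ℝ E] {x : ℝ → E}
    {t : ℝ} (ht : 0 < t) : derivWithin x (Ici 0) t = deriv x t :=
  derivWithin_of_mem_nhds (Ici_mem_nhds ht)

lemma ae_restrict_Icc_pos {a b : ℝ} (ha : 0 ≤ a) : ∀ᵐ t ∂volume.restrict (Icc a b), 0 < t := by
  have h : ∀ᵐ t ∂(volume : Measure ℝ), t ≠ 0 := by simp [ae_iff, measure_singleton]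
  filter_upwards [ae_restrict_of_ae h, ae_restrict_mem measurableSet_Icc] with t h0 ht
  exact lt_of_le_of_ne (ha.trans ht.1) h0.symm

theorem IsMildSolution.memLpLoc_derivWithin {hr : 0 < r} (hη : Represents hr η L)
    (hx : IsMildSolution L φ x) (hp : 1 ≤ p) (hφ : MemM φ p r) :
    MemLpLoc (derivWithin x (Ici 0)) p (Ici 0) := by
  intro a b hJ
  rcases lt_or_ge b a with hab | hab
  · simp [Icc_eq_empty hab.not_ge]
  have ha : 0 ≤ a := hJ (left_mem_Icc.2 hab)
  have hb := ha.trans hab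
  obtain ⟨g, hg, h⟩ := hx.exists_memLp_norm_sub_le hη hp (hx.memLp hη hφ (T := b + 1) (by linarith))
  have hd : derivWithin x (Ici 0) =ᵐ[volume.restrict (Icc a b)] deriv x :=
    (ae_restrict_Icc_pos ha).mono fun t ht => derivWithin_Ici_eq_deriv ht
  refine MemLp.ae_eq hd.symm ((hg.restrict _).mono (aestronglyMeasurable_deriv x _) ?_)
  filter_upwards [ae_restrict_of_ae (ae_norm_deriv_le_of_norm_sub_le (hg.locallyIntegrable hp) h),
    ae_restrict_of_ae (hx.ae_differentiableAt hη), ae_restrict_mem measurableSet_Icc]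
    with t h1 h2 h3
  have h0 := ha.trans h3.1
  exact (h1 ⟨h0, by linarith [h3.2]⟩ (h2 h0)).trans (le_abs_self _)

/-! ### The derivative as a Riemann–Stieltjes integral plus a forcing term -/

lemma measurable_of_boundedVariationOn_univ {w : ℝ → Fin n → 𝕜}
    (hw : BoundedVariationOn w univ) : Measurable w := by
  have hreal : ∀ v : ℝ → ℝ, BoundedVariationOn v univ → Measurable v := by
    intro v hv
    obtain ⟨q₁, q₂, h₁, h₂, rfl⟩ := hv.locallyBoundedVariationOn.exists_monotoneOn_sub_monotoneOn
    exact (monotoneOn_univ.1 h₁).measurable.sub (monotoneOn_univ.1 h₂).measurable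
  refine measurable_pi_iff.2 fun i => ?_
  have hi : BoundedVariationOn (fun t => w t i) univ :=
    (LipschitzWith.eval (α := fun _ : Fin n => 𝕜) i).comp_boundedVariationOn hw
  refine measurable_of_re_im (𝕜 := 𝕜) (hreal _ ?_) (hreal _ ?_)
  · exact (RCLike.reCLM (K := 𝕜)).lipschitz.comp_boundedVariationOn hi
  · exact (RCLike.imCLM (K := 𝕜)).lipschitz.comp_boundedVariationOn hi

/-- The history curve `t ↦ z_t ∈ C([-r, 0], E)`, where `z_t θ = z (t + θ)`, of a continuous
function `z : ℝ → E`. -/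
def historyCurve {E : Type*} [TopologicalSpace E] (r : ℝ) (z : C(ℝ, E)) :
    C(ℝ, C(Icc (-r) 0, E)) :=
  ContinuousMap.curry ⟨fun q : ℝ × Icc (-r) 0 => z (q.1 + q.2), by fun_prop⟩

/-- After time `r` the history consists of values of the continuous solution only, and the mild
solution is a classical one. -/
theorem IsMildSolution.hasDerivAt (hx : IsMildSolution L φ x) (hr : 0 < r) (z : C(ℝ, Fin n → 𝕜))
    (hz : ∀ t, 0 ≤ t → z t = x t) {t : ℝ} (ht : r < t) :
    HasDerivAt x (L (historyCurve r z t)) t := by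
  have hint : ∀ u v, IntervalIntegrable (historyCurve r z) volume u v :=
    fun u v => (historyCurve r z).continuous.intervalIntegrable u v
  have hcont : Continuous fun s => L (historyCurve r z s) :=
    L.continuous.comp (historyCurve r z).continuous
  have heq : ∀ u, r < u → x u = x r + ∫ s in r..u, L (historyCurve r z s) := by
    intro u hu
    -- The increment of the history integral is a Bochner integral in `C([-r, 0], 𝕜ⁿ)`.
    have h1 : historyIntegral hx.memLpLoc (hr.le.trans hu.le) - historyIntegral hx.memLpLoc hr.le =
        ∫ s in r..u, historyCurve r z s := by
      ext1 θ
      rw [historyIntegral_sub_apply]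
      change _ = ContinuousMap.evalCLM ℝ θ (∫ s in r..u, historyCurve r z s)
      rw [← ContinuousLinearMap.intervalIntegral_comp_comm _ (hint _ _)]
      refine intervalIntegral.integral_congr fun s hs => ?_
      rw [uIcc_of_le hu.le] at hs
      exact (hz _ (by linarith [θ.2.1, hs.1])).symm
    rw [ContinuousLinearMap.intervalIntegral_comp_comm L (hint _ _), ← h1,
      ← hx.sub_eq, add_sub_cancel]
  have hd : HasDerivAt (fun u => x r + ∫ s in r..u, L (historyCurve r z s))
      (L (historyCurve r z t)) t :=
    (intervalIntegral.integral_hasDerivAt_right (hcont.intervalIntegrable _ _)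
      (hcont.stronglyMeasurableAtFilter _ _) hcont.continuousAt).const_add _
  refine hd.congr_of_eventuallyEq ?_
  filter_upwards [Ioi_mem_nhds ht] with u hu using heq u hu

/-- If `z` is constantly `v` on `(-∞, 0]`, then `∫_{-t}^0 dη(θ) z(t + θ)` is obtained from `L z_t`
by removing the contribution of `[-r, -t]`, on which the integrand is `v`. For `t ≥ r` the correction
vanishes. -/
theorem Represents.hasRSIntegral_history {hr : 0 < r} (hη : Represents hr η L)
    (z : C(ℝ, Fin n → 𝕜)) {v : Fin n → 𝕜} (hz : ∀ s ≤ 0, z s = v) (t : ℝ) :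
    HasRSIntegral η (fun θ => z (t + θ)) (-t) 0
      (L (historyCurve r z t) - Matrix.mulVec (η (-t) - η (-r)) v) := by
  have hr0 : -r ≤ 0 := neg_nonpos.2 hr.le
  have h := (hη.eq_integral (historyCurve r z t)).congr (g := fun θ => z (t + θ)) fun θ hθ => by
    rw [IccExtend_of_mem _ _ hθ]
    rfl
  rcases le_total t r with htr | htr
  · exact h.restrict_of_eqOn_const (neg_le_neg htr) fun θ hθ => hz _ (by linarith [hθ.2])
  · rw [hη.const _ (neg_le_neg htr), sub_self, Matrix.zero_mulVec, sub_zero]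
    exact h.extend_left (neg_le_neg htr) hr0 hη.boundedVariationOn hη.const
      (by fun_prop)

lemma Represents.memLpLoc_mulVec {hr : 0 < r} (hη : Represents hr η L) (v : Fin n → 𝕜) :
    MemLpLoc (fun t => Matrix.mulVec (η (-t) - η (-r)) v) p (Ici 0) := by
  intro a b hJ
  have hr0 : -r ≤ 0 := neg_nonpos.2 hr.le
  -- `η` is uncontrolled on `(0, ∞)`, so measurability is shown for its composition with the
  -- projection to `[-r, 0]`, which has bounded variation on all of `ℝ`.
  set w : ℝ → Fin n → 𝕜 := fun θ => Matrix.mulVec (η (projIcc (-r) 0 hr0 θ) - η (-r)) v with hw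
  have hbv : BoundedVariationOn w univ := by
    have h1 : BoundedVariationOn (η ∘ fun θ => (projIcc (-r) 0 hr0 θ : ℝ)) univ :=
      ne_top_of_le_ne_top hη.boundedVariationOn (eVariationOn.comp_le_of_monotoneOn η _
        (fun s _ t _ hst => monotone_projIcc hr0 hst) fun θ _ => (projIcc (-r) 0 hr0 θ).2)
    have h2 : LipschitzWith ‖v‖₊ fun A : Matrix (Fin n) (Fin n) 𝕜 =>
        Matrix.mulVec (A - η (-r)) v := LipschitzWith.of_dist_le_mul fun A B => by
      rw [dist_eq_norm, dist_eq_norm, ← Matrix.sub_mulVec, sub_sub_sub_cancel_right, mul_comm]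
      exact Matrix.linfty_opNorm_mulVec _ _
    exact h2.comp_boundedVariationOn h1
  have hmeas : Measurable fun t : ℝ => w (-t) :=
    (measurable_of_boundedVariationOn_univ hbv).comp measurable_neg
  have hproj : ∀ θ ≤ 0, η (projIcc (-r) 0 hr0 θ) = η θ := by
    intro θ hθ
    rw [coe_projIcc, min_eq_right hθ]
    rcases le_total θ (-r) with h | h
    · rw [max_eq_left h, hη.const θ h]
    · rw [max_eq_right h]
  have heq : (fun t => w (-t)) =ᵐ[volume.restrict (Icc a b)]
      fun t => Matrix.mulVec (η (-t) - η (-r)) v := by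
    filter_upwards [ae_restrict_mem measurableSet_Icc] with t ht
    simp only [hw]
    rw [hproj _ (neg_nonpos.2 (hJ ht))]
  refine MemLp.ae_eq heq (MemLp.of_bound hmeas.aestronglyMeasurable
    ((eVariationOn η (Icc (-r) 0)).toReal * ‖v‖) (ae_of_all _ fun t => ?_))
  refine (Matrix.linfty_opNorm_mulVec _ _).trans (mul_le_mul_of_nonneg_right ?_ (norm_nonneg _))
  rw [← dist_eq_norm]
  exact hη.boundedVariationOn.dist_le (projIcc (-r) 0 hr0 _).2 (left_mem_Icc.2 hr0)

end RFDE

theorem theorem1p2 {𝕜 : Type*} [RCLike 𝕜] {n : ℕ} {r : ℝ} (hr : 0 < r)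
    (L : C(Icc (-r) 0, Fin n → 𝕜) →L[𝕜] (Fin n → 𝕜))
    (η : ℝ → Matrix (Fin n) (Fin n) 𝕜) (hη : RFDE.Represents hr η L)
    (p : ENNReal) (hp : 1 ≤ p)
    (φ : ℝ → Fin n → 𝕜) (hφ : RFDE.MemM φ p r)
    (x : ℝ → Fin n → 𝕜) (hx : RFDE.IsMildSolution L φ x) :
    RFDE.LocallyAbsolutelyContinuousOn x (Ici 0) ∧
    (∀ᵐ t ∂volume.restrict (Ici 0), DifferentiableWithinAt ℝ x (Ici 0) t) ∧
    RFDE.MemLpLoc (derivWithin x (Ici 0)) p (Ici 0) ∧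
    ∃ f : ℝ → Fin n → 𝕜,
      RFDE.MemLpLoc f p (Ici 0) ∧
      (∀ t, r ≤ t → f t = 0) ∧
      ∀ᵐ t ∂volume.restrict (Ici 0), ∃ I : Fin n → 𝕜,
        RFDE.HasRSIntegral η (fun θ => x (t + θ)) (-t) 0 I ∧
        derivWithin x (Ici 0) t = I + f t := by
  have hderiv := hx.memLpLoc_derivWithin hη hp hφ
  refine ⟨hx.locallyAbsolutelyContinuousOn hη, ?_, hderiv, ?_⟩
  · filter_upwards [ae_restrict_of_ae (hx.ae_differentiableAt hη), ae_restrict_mem measurableSet_Ici]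
      with t h ht using (h ht).differentiableWithinAt
  -- The continuous extension of `x|_[0, ∞)` by the constant `x 0` to the left.
  have hzc : Continuous fun s : ℝ => x (max s 0) :=
    (hx.continuousOn hη).comp_continuous (by fun_prop) fun s => le_max_right s 0
  let z : C(ℝ, Fin n → 𝕜) := ⟨fun s => x (max s 0), hzc⟩
  have hz : ∀ t, 0 ≤ t → z t = x t := fun t ht => congrArg x (max_eq_left ht)
  have hz0 : ∀ s ≤ 0, z s = x 0 := fun s hs => congrArg x (max_eq_right hs)
  set I : ℝ → Fin n → 𝕜 := fun t =>
    L (RFDE.historyCurve r z t) - Matrix.mulVec (η (-t) - η (-r)) (x 0) with hI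
  have hImem : RFDE.MemLpLoc I p (Ici 0) := fun a b hJ =>
    (RFDE.memLp_restrict_Icc_of_continuousOn
      (L.continuous.comp (RFDE.historyCurve r z).continuous).continuousOn).sub
        (hη.memLpLoc_mulVec (x 0) a b hJ)
  -- On `[0, r)` the forcing term is defined as the difference of the derivative and the integral;
  -- for `t > r` that difference vanishes.
  refine ⟨(Iio r).indicator fun t => derivWithin x (Ici 0) t - I t, fun a b hJ =>
    ((hderiv a b hJ).sub (hImem a b hJ)).indicator measurableSet_Iio,
    fun t ht => indicator_of_notMem (notMem_Iio.2 ht) _, ?_⟩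
  have hne : ∀ᵐ t ∂(volume : Measure ℝ), t ≠ r := by simp [ae_iff, measure_singleton]
  filter_upwards [ae_restrict_mem measurableSet_Ici, ae_restrict_of_ae hne] with t ht htr
  refine ⟨I t, (hη.hasRSIntegral_history z hz0 t).congr fun θ hθ => hz _ (by linarith [hθ.1]), ?_⟩
  rcases lt_or_gt_of_ne htr with h | h
  · rw [indicator_of_mem (mem_Iio.2 h), add_sub_cancel]
  · rw [indicator_of_notMem (notMem_Iio.2 h.le), add_zero, hI,
      RFDE.derivWithin_Ici_eq_deriv (hr.trans h), (hx.hasDerivAt hr z hz h).deriv]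
    simp only
    rw [hη.const _ (neg_le_neg h.le), sub_self, Matrix.zero_mulVec, sub_zero]
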